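/- Let $k$ be a field, let $n\le m$ be non-negative integers, let $R=k[x_{ij}\mid 1\le i\le n,\ 1\le j\le m]$ with its standard grading, and let $M=(x_{ij})$ be the generic $n\times m$ matrix, viewed as a map $M:F\to G$ of free $R$-modules with bases $f_1,\dots,f_m$ and $g_1,\dots,g_n$. Let $<$ be the lexicographic order on $R$ with $x_{11}>x_{12}>\cdots>x_{1m}>x_{21}>\cdots>x_{nm}$. Let $\Delta$ be a simplicial complex on the vertex set $[m]$, i.e. a family of subsets of $[m]$ closed under taking subsets. Let $\mathcal C^<_\bullet(\Delta,M)$ be the following complex of graded free $R$-modules. Put $\mathcal C^<_0(\Delta,M)=\bigwedge^nG\cong R$, generated in degree $0$. For $i\ge1$ let $\mathcal C^<_i(\Delta,M)\subseteq D_{i-1}(G^*)\otimes\bigwedge^{n+i-1}F$ be the free submodule with basis the elements $g^{*(\alpha)}\otimes f_\sigma$ with $\alpha=(\alpha_1,\dots,\alpha_n)\in\mathbb Z_{\ge0}^n$, $|\alpha|=i-1$, $\sigma\in\Delta$, $|\sigma|=n+i-1$; these basis elements have degree $n+i-1$. The first differential is $d_1(f_\sigma)=\operatorname{in}_<(\det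 M_\sigma)$, the initial term of the maximal minor of $M$ on the columns in $\sigma$. For $\ell\ge2$ and $\sigma=\{\sigma_1<\cdots<\sigma_{n+\ell-1}\}$, $$d_\ell(g^{*(\alpha)}\otimes f_\sigma)=\sum_{(i,\sigma_j)\in\mathcal I_<(\alpha,\sigma)}(-1)^{j+1}x_{i\sigma_j}\,g^{*(\alpha-\epsilon_i)}\otimes f_{\sigma\setminus\sigma_j},$$ where $\epsilon_i$ is the $i$-th unit vector and $\mathcal I_<(\alpha,\sigma)=\{(i,\sigma_{i+j})\mid \alpha_i>0,\ \alpha_1+\cdots+\alpha_{i-1}\le j\le\alpha_1+\cdots+\alpha_i\}$. A $1$-nonface of $\Delta$ is a set $\sigma=\{\sigma_1<\cdots<\sigma_l\}\subseteq[m]$ with $\sigma\notin\Delta$ such that for some $1\le j<l$ both $\sigma\setminus\sigma_j$ and $\sigma\setminus\sigma_{j+1}$ belong to $\Delta$. Then the following are equivalent: 1. $H_1(\mathcal C^<_\bullet(\Delta,M))_{n+1}=0$; 2. $\Delta$ has no $1$-nonfaces of cardinality $n+1$. Moreover, if $\sigma\notin\Delta$ has cardinality $n+1$ and $\sigma\setminus\sigma_j,\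 \sigma\setminus\sigma_{j+1}\in\Delta$ for some $1\le j\le n$, then $$z=(-1)^{j+1}\bigl(x_{j\sigma_j}f_{\sigma\setminus\sigma_j}-x_{j\sigma_{j+1}}f_{\sigma\setminus\sigma_{j+1}}\bigr)\in\mathcal C^<_1(\Delta,M)$$ is a cycle that is not a boundary. -/

import Mathlib

open CategoryTheory

noncomputable section

namespace SparseEN

universe u

/-- The polynomial ring `k[x_{ij} | 1 ≤ i ≤ n, 1 ≤ j ≤ m]`. All indices are shifted to start at
`0`. The variables are indexed by the lexicographically ordered product, so that for the order
`MonomialOrder.lex` one has `x_{11} > x_{12} > ⋯ > x_{1m} > x_{21} > ⋯ > x_{nm}`. -/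
abbrev PolyRing (k : Type u) [Field k] (n m : ℕ) : Type u := MvPolynomial (Fin n ×ₗ Fin m) k

/-- The variable `x_{ij}`. -/
abbrev x (k : Type u) [Field k] {n m : ℕ} (i : Fin n) (j : Fin m) : PolyRing k n m :=
  MvPolynomial.X (toLex (i, j))

/-- The generic `n × m` matrix `M = (x_{ij})`. -/
def genericMatrix (k : Type u) [Field k] (n m : ℕ) : Matrix (Fin n) (Fin m) (PolyRing k n m) :=
  Matrix.of fun i j => x k i j

/-- The maximal minor of `M` on the columns `I = {i_1 < ⋯ < i_n}`; this is the coefficient of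
`⋀ⁿ M (f_I)` with respect to the basis `g_1 ∧ ⋯ ∧ g_n` of `⋀ⁿ G`. -/
def maxMinor (k : Type u) [Field k] {n m : ℕ} (I : Finset (Fin m)) (h : I.card = n) :
    PolyRing k n m :=
  ((genericMatrix k n m).submatrix id (I.orderEmbOfFin h)).det

/-- The ambient free module with basis the symbols `g^{*(α)} ⊗ f_σ`, for all multi-indices
`α = (α_1, …, α_n)` and all `σ ⊆ [m]`, that is `⨁_{a, b} D_a(G^*) ⊗ ⋀^b F`. -/
abbrev Ambient (k : Type u) [Field k] (n m : ℕ) : Type u :=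
  ((Fin n → ℕ) × Finset (Fin m)) →₀ PolyRing k n m

/-- The basis element `g^{*(α)} ⊗ f_σ`. -/
def basisElt (k : Type u) [Field k] {n m : ℕ} (α : Fin n → ℕ) (σ : Finset (Fin m)) :
    Ambient k n m :=
  Finsupp.single (α, σ) 1

/-- The position, counted from `0`, of an element `v` of `σ = {σ_0 < σ_1 < ⋯}`. -/
def pos {m : ℕ} (σ : Finset (Fin m)) (v : Fin m) : ℕ := (σ.filter (· < v)).card

/-- The indexing set `I_<(α, σ)`: the pairs `(i, σ_{i+j})` with `α_i > 0` and
`|α_{≤ i-1}| ≤ j ≤ |α_{≤ i}|`. (Both `i` and positions are shifted by one, so that the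
relation "position = `i + j`" is unchanged.) -/
def indexSet {n m : ℕ} (α : Fin n → ℕ) (σ : Finset (Fin m)) : Finset (Fin n × Fin m) :=
  Finset.univ.filter fun p => 0 < α p.1 ∧ p.2 ∈ σ ∧
    p.1.val + ∑ l ∈ Finset.Iio p.1, α l ≤ pos σ p.2 ∧
    pos σ p.2 ≤ p.1.val + ∑ l ∈ Finset.Iic p.1, α l

/-- The sparse Eagon-Northcott differential
`g^{*(α)} ⊗ f_σ ↦ ∑_{(i, σ_j) ∈ I_<(α, σ)} (-1)^{j+1} x_{i σ_j} g^{*(α - ε_i)} ⊗ f_{σ \ σ_j}`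
(the sign is `(-1)^j` when `j` is counted from `0`). -/
def sparseDiff (k : Type u) [Field k] (n m : ℕ) :
    Ambient k n m →ₗ[PolyRing k n m] Ambient k n m :=
  Finsupp.linearCombination (PolyRing k n m) fun b =>
    ∑ p ∈ indexSet b.1 b.2, ((-1) ^ pos b.2 p.2 * x k p.1 p.2) •
      basisElt k (b.1 - Pi.single p.1 1) (b.2.erase p.2)

open Classical in
/-- The first differential `f_I ↦ in_<(M(f_I))`, for `I` of cardinality `n`. Here `⋀ⁿ G` is
identified with the ring through its basis `g_1 ∧ ⋯ ∧ g_n`; the value on the basis elements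
with `|I| ≠ n`, none of which lies in the first module of the complex, is irrelevant. -/
def initialDiff (k : Type u) [Field k] (n m : ℕ) :
    Ambient k n m →ₗ[PolyRing k n m] PolyRing k n m :=
  Finsupp.linearCombination (PolyRing k n m) fun b =>
    if h : b.2.card = n then MonomialOrder.lex.leadingTerm (maxMinor k b.2 h) else 0

/-- The module `C^<_{i+1}(Δ, M)` for `i ≥ 0`: the free submodule of `D_i(G^*) ⊗ ⋀^{n+i} F`
generated by all `g^{*(α)} ⊗ f_σ` with `|α| = i`, `|σ| = n + i` and `σ ∈ Δ`. A simplicial complex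
on `[m]` is a family of subsets of `[m]` that is closed under passing to subsets. -/
def chains (k : Type u) [Field k] (n : ℕ) {m : ℕ} (Δ : LowerSet (Finset (Fin m))) (i : ℕ) :
    Submodule (PolyRing k n m) (Ambient k n m) :=
  Submodule.span _ {c | ∃ (α : Fin n → ℕ) (σ : Finset (Fin m)),
    ∑ l, α l = i ∧ σ.card = n + i ∧ σ ∈ Δ ∧ c = basisElt k α σ}

section

variable {k : Type u} [Field k] {n m : ℕ}

theorem sparseDiff_basisElt (α : Fin n → ℕ) (σ : Finset (Fin m)) :
    sparseDiff k n m (basisElt k α σ) =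
      ∑ p ∈ indexSet α σ, ((-1) ^ pos σ p.2 * x k p.1 p.2) •
        basisElt k (α - Pi.single p.1 1) (σ.erase p.2) := by
  simp [sparseDiff, basisElt, Finsupp.linearCombination_single]

theorem sum_sub_single (α : Fin n → ℕ) (i : Fin n) (hi : 0 < α i) (s : Finset (Fin n)) :
    ∑ l ∈ s, α l = ∑ l ∈ s, (α - Pi.single i 1 : Fin n → ℕ) l + (if i ∈ s then 1 else 0) := by
  have h1 : ∀ l, α l = (α - Pi.single i 1 : Fin n → ℕ) l + (if i = l then 1 else 0) := by
    intro l
    by_cases h : i = l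
    · subst h; simp; omega
    · simp [h, Ne.symm h]
  rw [Finset.sum_congr rfl fun l _ => h1 l, Finset.sum_add_distrib, Finset.sum_ite_eq]

theorem sparseDiff_mem (Δ : LowerSet (Finset (Fin m))) (i : ℕ) :
    ∀ c ∈ chains k n Δ (i + 1), sparseDiff k n m c ∈ chains k n Δ i := by
  suffices h : chains k n Δ (i + 1) ≤ (chains k n Δ i).comap (sparseDiff k n m) from h
  refine Submodule.span_le.2 ?_
  rintro _ ⟨α, σ, hα, hc, hσ, rfl⟩
  simp only [Submodule.comap_coe, Set.mem_preimage, SetLike.mem_coe, sparseDiff_basisElt]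
  refine Submodule.sum_mem _ fun p hp => Submodule.smul_mem _ _ (Submodule.subset_span ?_)
  simp only [indexSet, Finset.mem_filter, Finset.mem_univ, true_and] at hp
  refine ⟨_, _, ?_, ?_, Δ.lower (Finset.erase_subset _ _) hσ, rfl⟩
  · have := sum_sub_single α p.1 hp.1 Finset.univ
    simp only [Finset.mem_univ, if_true] at this
    omega
  · rw [Finset.card_erase_of_mem hp.2.1]; omega

theorem pos_erase (σ : Finset (Fin m)) (u v : Fin m) (hu : u ∈ σ) :
    pos σ v = pos (σ.erase u) v + (if u < v then 1 else 0) := by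
  unfold pos
  rw [Finset.filter_erase]
  split_ifs with h
  · rw [Finset.card_erase_add_one]; simp [hu, h]
  · rw [Finset.erase_eq_of_notMem]; simp; simp [h]

theorem pos_lt (σ : Finset (Fin m)) (u v : Fin m) (hu : u ∈ σ) (h : u < v) :
    pos σ u < pos σ v := by
  refine Finset.card_lt_card (Finset.ssubset_iff_of_subset ?_ |>.2 ⟨u, ?_, ?_⟩)
  · intro w; simp only [Finset.mem_filter]; exact fun hw => ⟨hw.1, hw.2.trans h⟩
  · simp [hu, h]
  · simp

theorem indexSet_swap (α : Fin n → ℕ) (σ : Finset (Fin m)) (p q : Fin n × Fin m)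
    (hp : p ∈ indexSet α σ) (hq : q ∈ indexSet (α - Pi.single p.1 1) (σ.erase p.2)) :
    q ∈ indexSet α σ ∧ p ∈ indexSet (α - Pi.single q.1 1) (σ.erase q.2) := by
  obtain ⟨a, u⟩ := p
  obtain ⟨b, v⟩ := q
  simp only [indexSet, Finset.mem_filter, Finset.mem_univ, true_and, Finset.mem_erase] at *
  obtain ⟨ha, hu, hp1, hp2⟩ := hp
  obtain ⟨hb, ⟨hvu, hv⟩, hq1, hq2⟩ := hq
  have hb' : 0 < α b := lt_of_lt_of_le hb (by simp)
  have e1 := sum_sub_single α a ha (Finset.Iio b)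
  have e2 := sum_sub_single α a ha (Finset.Iic b)
  have e3 := sum_sub_single α b hb' (Finset.Iio a)
  have e4 := sum_sub_single α b hb' (Finset.Iic a)
  have s1 := Finset.sum_Iio_add_eq_sum_Iic (f := α) a
  have s2 := Finset.sum_Iio_add_eq_sum_Iic (f := α) b
  have r1 := pos_erase σ u v hu
  have r2 := pos_erase σ v u hv
  simp only [Finset.mem_Iio, Finset.mem_Iic] at e1 e2 e3 e4
  have huv : (u < v ∧ ¬ v < u ∧ pos σ u < pos σ v) ∨ (v < u ∧ ¬ u < v ∧ pos σ v < pos σ u) := by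
    rcases lt_or_gt_of_ne hvu with h | h
    · exact Or.inr ⟨h, h.asymm, pos_lt σ v u hv h⟩
    · exact Or.inl ⟨h, h.asymm, pos_lt σ u v hu h⟩
  rcases lt_trichotomy a b with hab | hab | hab
  · have hs : ∑ l ∈ Finset.Iic a, α l ≤ ∑ l ∈ Finset.Iio b, α l :=
      Finset.sum_le_sum_of_subset fun w hw =>
        Finset.mem_Iio.2 ((Finset.mem_Iic.1 hw).trans_lt hab)
    have h0 : (α - Pi.single b 1 : Fin n → ℕ) a = α a := by simp [hab.ne]
    have hab' : a.val < b.val := hab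
    simp only [hab, hab.le, hab.not_ge, hab.asymm, if_true, if_false] at e1 e2 e3 e4
    rw [h0]
    rcases huv with ⟨h1, h2, h3⟩ | ⟨h1, h2, h3⟩ <;> simp only [h1, h2, if_true, if_false] at r1 r2 <;>
      refine ⟨⟨hb', hv, ?_, ?_⟩, ha, ⟨hvu.symm, hu⟩, ?_, ?_⟩ <;> omega
  · subst hab
    simp only [lt_irrefl, le_refl, if_true, if_false] at e1 e2 e3 e4
    rcases huv with ⟨h1, h2, h3⟩ | ⟨h1, h2, h3⟩ <;> simp only [h1, h2, if_true, if_false] at r1 r2 <;>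
      refine ⟨⟨hb', hv, ?_, ?_⟩, hb, ⟨hvu.symm, hu⟩, ?_, ?_⟩ <;> omega
  · have hs : ∑ l ∈ Finset.Iic b, α l ≤ ∑ l ∈ Finset.Iio a, α l :=
      Finset.sum_le_sum_of_subset fun w hw =>
        Finset.mem_Iio.2 ((Finset.mem_Iic.1 hw).trans_lt hab)
    have h0 : (α - Pi.single b 1 : Fin n → ℕ) a = α a := by simp [hab.ne']
    have hab' : b.val < a.val := hab
    simp only [hab, hab.le, hab.not_ge, hab.asymm, if_true, if_false] at e1 e2 e3 e4
    rw [h0]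
    rcases huv with ⟨h1, h2, h3⟩ | ⟨h1, h2, h3⟩ <;> simp only [h1, h2, if_true, if_false] at r1 r2 <;>
      refine ⟨⟨hb', hv, ?_, ?_⟩, ha, ⟨hvu.symm, hu⟩, ?_, ?_⟩ <;> omega

theorem sparseDiff_sparseDiff_basisElt (α : Fin n → ℕ) (σ : Finset (Fin m)) :
    sparseDiff k n m (sparseDiff k n m (basisElt k α σ)) = 0 := by
  rw [sparseDiff_basisElt, map_sum]
  simp only [map_smul, sparseDiff_basisElt, Finset.smul_sum]
  rw [Finset.sum_sigma']
  have key : ∀ z ∈ (indexSet α σ).sigma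
      fun p => indexSet (α - Pi.single p.1 1) (σ.erase p.2),
      z.1 ∈ indexSet α σ ∧ z.2 ∈ indexSet (α - Pi.single z.1.1 1) (σ.erase z.1.2) :=
    fun z hz => Finset.mem_sigma.1 hz
  have hne : ∀ z ∈ (indexSet α σ).sigma
      fun p => indexSet (α - Pi.single p.1 1) (σ.erase p.2),
      z.1.2 ∈ σ ∧ z.2.2 ∈ σ ∧ z.2.2 ≠ z.1.2 := by
    intro z hz
    have h1 := (key z hz).1
    have h2 := (key z hz).2
    simp only [indexSet, Finset.mem_filter, Finset.mem_univ, true_and, Finset.mem_erase] at h1 h2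
    exact ⟨h1.2.1, h2.2.1.2, h2.2.1.1⟩
  refine Finset.sum_involution (fun z _ => ⟨z.2, z.1⟩) ?_ ?_ ?_ ?_
  · intro z hz
    obtain ⟨hu, hv, hvu⟩ := hne z hz
    have r1 := pos_erase σ z.1.2 z.2.2 hu
    have r2 := pos_erase σ z.2.2 z.1.2 hv
    rw [smul_smul, smul_smul, Finset.erase_right_comm, tsub_right_comm, ← add_smul]
    refine (congrArg (· • _) ?_).trans (zero_smul (PolyRing k n m) _)
    rcases lt_or_gt_of_ne hvu with h | h
    · simp only [h, h.asymm, if_true, if_false, add_zero] at r1 r2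
      rw [r1, r2]; ring
    · simp only [h, h.asymm, if_true, if_false, add_zero] at r1 r2
      rw [r1, r2]; ring
  · intro z hz _ h
    have := congrArg (fun w => w.1.2) h
    exact (hne z hz).2.2 this
  · intro z hz
    exact Finset.mem_sigma.2 (indexSet_swap α σ z.1 z.2 (key z hz).1 (key z hz).2)
  · intro z hz; rfl

theorem sparseDiff_sparseDiff (c : Ambient k n m) :
    sparseDiff k n m (sparseDiff k n m c) = 0 := by
  suffices h : (sparseDiff k n m).comp (sparseDiff k n m) = 0 from LinearMap.congr_fun h c
  refine Finsupp.lhom_ext' fun b => LinearMap.ext_ring ?_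
  exact sparseDiff_sparseDiff_basisElt b.1 b.2

theorem orderEmb_erase (σ : Finset (Fin m)) (h : σ.card = n + 1) (p : Fin (n + 1))
    (h' : (σ.erase (σ.orderEmbOfFin h p)).card = n) (a : Fin n) :
    (σ.erase (σ.orderEmbOfFin h p)).orderEmbOfFin h' a = σ.orderEmbOfFin h (p.succAbove a) := by
  refine (congrFun (Finset.orderEmbOfFin_unique h'
    (f := fun a => σ.orderEmbOfFin h (p.succAbove a)) (fun b => ?_) ?_) a).symm
  · simp [Finset.mem_erase, Finset.orderEmbOfFin_mem, Fin.succAbove_ne]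
  · exact (σ.orderEmbOfFin h).strictMono.comp (Fin.strictMono_succAbove p)

theorem pos_orderEmb (σ : Finset (Fin m)) {l : ℕ} (h : σ.card = l) (j : Fin l) :
    pos σ (σ.orderEmbOfFin h j) = j := by
  have : σ.filter (· < σ.orderEmbOfFin h j) =
      (Finset.Iio j).map (σ.orderEmbOfFin h).toEmbedding := by
    ext v
    simp only [Finset.mem_filter, Finset.mem_map, Finset.mem_Iio]
    constructor
    · rintro ⟨hv, hlt⟩
      have : v ∈ Set.range (σ.orderEmbOfFin h) := by simpa using hv
      obtain ⟨a, rfl⟩ := this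
      exact ⟨a, by simpa using hlt, rfl⟩
    · rintro ⟨a, ha, rfl⟩
      exact ⟨Finset.orderEmbOfFin_mem _ _ _, by simpa using ha⟩
  rw [pos, this]; simp

/-- The exponent of the monomial `∏ᵢ x_{i, c(i)}`. -/
def rowExp (c : Fin n → Fin m) : (Fin n ×ₗ Fin m) →₀ ℕ :=
  ∑ i, Finsupp.single (toLex (i, c i)) 1

theorem rowExp_apply (c : Fin n → Fin m) (a : Fin n) (v : Fin m) :
    rowExp c (toLex (a, v)) = if c a = v then 1 else 0 := by
  simp only [rowExp, Finsupp.finsetSum_apply, Finsupp.single_apply, toLex_inj, Prod.mk.injEq]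
  rw [Finset.sum_eq_single a] <;> simp +contextual

theorem rowExp_lt (c : Fin n → Fin m) (hc : StrictMono c) (π : Equiv.Perm (Fin n)) (hπ : π ≠ 1) :
    toLex (rowExp (fun i => c (π i))) < toLex (rowExp c) := by
  have hex : ∃ a, π a ≠ a := by
    by_contra! h
    exact hπ (Equiv.ext h)
  obtain ⟨a, ha, hmin⟩ := WellFounded.has_min (wellFounded_lt (α := Fin n)) {a | π a ≠ a} hex
  have hfix : ∀ b < a, π b = b := fun b hb => by
    by_contra h
    exact hmin b h hb
  have hlt : a < π a := by
    rcases lt_trichotomy a (π a) with h | h | h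
    · exact h
    · exact absurd h.symm ha
    · exact absurd (π.injective (hfix _ h)) ha
  rw [Finsupp.Lex.lt_iff]
  refine ⟨toLex (a, c a), ?_, ?_⟩
  · intro j hj
    obtain ⟨⟨b, v⟩, rfl⟩ := toLex.surjective j
    change rowExp _ (toLex (b, v)) = rowExp _ (toLex (b, v))
    rw [rowExp_apply, rowExp_apply]
    rcases Prod.Lex.toLex_lt_toLex.1 hj with h | ⟨h, h'⟩
    · rw [hfix b h]
    · simp only at h h'
      subst h
      rw [if_neg (h'.trans (hc hlt)).ne', if_neg h'.ne']
  · change rowExp _ (toLex (a, c a)) < rowExp _ (toLex (a, c a))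
    rw [rowExp_apply, rowExp_apply, if_neg (hc hlt).ne', if_pos rfl]
    exact zero_lt_one

theorem leadingTerm_maxMinor (I : Finset (Fin m)) (h : I.card = n) :
    MonomialOrder.lex.leadingTerm (maxMinor k I h) = ∏ i, x k i (I.orderEmbOfFin h i) := by
  set c : Fin n → Fin m := fun i => I.orderEmbOfFin h i with hcdef
  have hc : StrictMono c := (I.orderEmbOfFin h).strictMono
  have hprod : ∀ d : Fin n → Fin m, ∏ i, x k i (d i) = MvPolynomial.monomial (rowExp d) 1 := by
    intro d
    rw [rowExp, MvPolynomial.monomial_sum_one]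
    rfl
  have hdet : maxMinor k I h = ∑ π : Equiv.Perm (Fin n), Equiv.Perm.sign π •
      MvPolynomial.monomial (rowExp fun i => c (π i)) (1 : k) := by
    rw [maxMinor, ← Matrix.det_transpose, Matrix.det_apply]
    refine Finset.sum_congr rfl fun π _ => ?_
    rw [← hprod]
    rfl
  have hcoeff : ∀ u, MvPolynomial.coeff u (maxMinor k I h) = ∑ π : Equiv.Perm (Fin n),
      Equiv.Perm.sign π • (if rowExp (fun i => c (π i)) = u then (1 : k) else 0) := by
    intro u
    rw [hdet, MvPolynomial.coeff_sum]
    refine Finset.sum_congr rfl fun π _ => ?_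
    rw [Units.smul_def, Units.smul_def, MvPolynomial.coeff_smul, MvPolynomial.coeff_monomial]
  have hone : MvPolynomial.coeff (rowExp c) (maxMinor k I h) = 1 := by
    rw [hcoeff, Finset.sum_eq_single 1]
    · simp
    · intro π _ hπ
      rw [if_neg, smul_zero]
      intro he
      exact (rowExp_lt c hc π hπ).ne (congrArg toLex he)
    · simp
  have hdeg : MonomialOrder.lex.degree (maxMinor k I h) = rowExp c := by
    apply MonomialOrder.lex.toSyn.injective
    apply le_antisymm
    · rw [MonomialOrder.degree_le_iff]
      intro u hu
      rw [MvPolynomial.mem_support_iff, hcoeff] at hu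
      obtain ⟨π, -, hπ⟩ := Finset.exists_ne_zero_of_sum_ne_zero hu
      have hu' : rowExp (fun i => c (π i)) = u := by
        by_contra hne
        rw [if_neg hne, smul_zero] at hπ
        exact hπ rfl
      rw [MonomialOrder.lex_le_iff, ← hu']
      by_cases h1 : π = 1
      · subst h1; rfl
      · exact (rowExp_lt c hc π h1).le
    · exact MonomialOrder.le_degree (by rw [MvPolynomial.mem_support_iff, hone]; exact one_ne_zero)
  rw [MonomialOrder.leadingTerm, MonomialOrder.leadingCoeff, hdeg, hone, ← hprod]

theorem initialDiff_basisElt (α : Fin n → ℕ) (σ : Finset (Fin m)) (h : σ.card = n) :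
    initialDiff k n m (basisElt k α σ) = ∏ i, x k i (σ.orderEmbOfFin h i) := by
  simp [initialDiff, basisElt, Finsupp.linearCombination_single, h, leadingTerm_maxMinor]

theorem indexSet_single (i : Fin n) (σ : Finset (Fin m)) (h : σ.card = n + 1) :
    indexSet (Pi.single i 1) σ =
      {(i, σ.orderEmbOfFin h i.castSucc), (i, σ.orderEmbOfFin h i.succ)} := by
  have hs1 : ∑ l ∈ Finset.Iio i, (Pi.single i 1 : Fin n → ℕ) l = 0 :=
    Finset.sum_eq_zero fun l hl => by simp [(Finset.mem_Iio.1 hl).ne]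
  have hs2 := Finset.sum_Iio_add_eq_sum_Iic (f := (Pi.single i 1 : Fin n → ℕ)) i
  rw [hs1, Pi.single_eq_same] at hs2
  ext ⟨a, v⟩
  simp only [indexSet, Finset.mem_filter, Finset.mem_univ, true_and, Finset.mem_insert,
    Finset.mem_singleton, Prod.mk.injEq]
  by_cases ha : a = i
  · subst ha
    rw [hs1, ← hs2]
    simp only [Pi.single_eq_same, zero_lt_one, true_and]
    constructor
    · rintro ⟨hv, h1, h2⟩
      have : v ∈ Set.range (σ.orderEmbOfFin h) := by simpa using hv
      obtain ⟨j, rfl⟩ := this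
      rw [pos_orderEmb] at h1 h2
      rcases (by omega : j.val = a.val ∨ j.val = a.val + 1) with h3 | h3
      · left; congr 1; exact Fin.ext h3
      · right; congr 1; exact Fin.ext h3
    · rintro (rfl | rfl) <;> refine ⟨Finset.orderEmbOfFin_mem _ _ _, ?_⟩ <;>
        rw [pos_orderEmb] <;> simp
  · simp [ha]

theorem initialDiff_sparseDiff (Δ : LowerSet (Finset (Fin m))) :
    ∀ c ∈ chains k n Δ 1, initialDiff k n m (sparseDiff k n m c) = 0 := by
  suffices h : chains k n Δ 1 ≤ LinearMap.ker ((initialDiff k n m).comp (sparseDiff k n m)) from h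
  refine Submodule.span_le.2 ?_
  rintro _ ⟨α, σ, hα, hc, -, rfl⟩
  obtain ⟨i, rfl⟩ : ∃ i, α = Pi.single i 1 := by
    have : ∃ i, 0 < α i := by
      by_contra! h0
      simp [Finset.sum_eq_zero fun l _ => Nat.le_zero.1 (h0 l)] at hα
    obtain ⟨i, hi⟩ := this
    have hsum := sum_sub_single α i hi Finset.univ
    simp only [Finset.mem_univ, if_true] at hsum
    have hz : ∑ l, (α - Pi.single i 1 : Fin n → ℕ) l = 0 := by omega
    rw [Finset.sum_eq_zero_iff] at hz
    refine ⟨i, funext fun l => ?_⟩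
    have := hz l (Finset.mem_univ _)
    by_cases hl : l = i
    · subst hl
      simp only [Pi.sub_apply, Pi.single_eq_same] at this ⊢
      omega
    · simpa [Pi.single_apply, hl] using this
  simp only [SetLike.mem_coe, LinearMap.mem_ker, LinearMap.comp_apply]
  have hne : (i, σ.orderEmbOfFin hc i.castSucc) ≠ (i, σ.orderEmbOfFin hc i.succ) := by
    intro he
    have := (σ.orderEmbOfFin hc).injective (Prod.mk.inj he).2
    exact (Fin.castSucc_lt_succ (i := i)).ne this
  have hcard : ∀ p, (σ.erase (σ.orderEmbOfFin hc p)).card = n := fun p => by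
    rw [Finset.card_erase_of_mem (Finset.orderEmbOfFin_mem _ _ _), hc]; rfl
  rw [sparseDiff_basisElt, indexSet_single i σ hc, Finset.sum_pair hne, map_add, map_smul,
    map_smul, initialDiff_basisElt _ _ (hcard _), initialDiff_basisElt _ _ (hcard _)]
  simp only [orderEmb_erase, pos_orderEmb, smul_eq_mul, Fin.val_castSucc, Fin.val_succ]
  rw [← Finset.mul_prod_erase _ _ (Finset.mem_univ i),
    ← Finset.mul_prod_erase _ (fun a => x k a (σ.orderEmbOfFin hc (i.succ.succAbove a)))
      (Finset.mem_univ i)]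
  have hrest : ∏ a ∈ Finset.univ.erase i, x k a (σ.orderEmbOfFin hc (i.succ.succAbove a)) =
      ∏ a ∈ Finset.univ.erase i, x k a (σ.orderEmbOfFin hc (i.castSucc.succAbove a)) := by
    refine Finset.prod_congr rfl fun a ha => ?_
    have hai : a.val ≠ i.val := fun he => (Finset.mem_erase.1 ha).1 (Fin.ext he)
    congr 2
    simp only [Fin.succAbove, Fin.lt_def, Fin.val_castSucc, Fin.val_succ]
    split_ifs <;> first | rfl | omega
  rw [hrest, Fin.succAbove_castSucc_self, Fin.succAbove_succ_self]
  ring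

end

/-- The modules of the complex `C^<_•(Δ, M)`. -/
def complexX (k : Type u) [Field k] (n : ℕ) {m : ℕ} (Δ : LowerSet (Finset (Fin m))) :
    ℕ → ModuleCat.{u} (PolyRing k n m)
  | 0 => ModuleCat.of _ (PolyRing k n m)
  | i + 1 => ModuleCat.of _ (chains k n Δ i)

/-- The differentials of the complex `C^<_•(Δ, M)`. -/
def complexD (k : Type u) [Field k] (n : ℕ) {m : ℕ} (Δ : LowerSet (Finset (Fin m))) :
    (i : ℕ) → (complexX k n Δ (i + 1) ⟶ complexX k n Δ i)
  | 0 => ModuleCat.ofHom ((initialDiff k n m).domRestrict (chains k n Δ 0))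
  | i + 1 => ModuleCat.ofHom ((sparseDiff k n m).restrict (sparseDiff_mem Δ i))

theorem complexD_comp (k : Type u) [Field k] (n : ℕ) {m : ℕ} (Δ : LowerSet (Finset (Fin m)))
    (i : ℕ) : complexD k n Δ (i + 1) ≫ complexD k n Δ i = 0 := by
  cases i with
  | zero =>
    refine ModuleCat.hom_ext (LinearMap.ext fun c => ?_)
    exact initialDiff_sparseDiff Δ c.1 c.2
  | succ i =>
    refine ModuleCat.hom_ext (LinearMap.ext fun c => ?_)
    exact Subtype.ext (sparseDiff_sparseDiff c.1)

/-- The generalized sparse Eagon-Northcott complex `C^<_•(Δ, M)`. -/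
def sparseComplex (k : Type u) [Field k] (n : ℕ) {m : ℕ} (Δ : LowerSet (Finset (Fin m))) :
    ChainComplex (ModuleCat.{u} (PolyRing k n m)) ℕ :=
  ChainComplex.of (complexX k n Δ) (complexD k n Δ) (complexD_comp k n Δ)

/-- The elements of internal degree `d` of the `i`-th module of `C^<_•(Δ, M)`, for the standard
grading of the polynomial ring: `⋀ⁿ G` is generated in degree `0`, and for `i ≥ 0` the basis
elements `g^{*(α)} ⊗ f_σ` of `C^<_{i+1}(Δ, M)` have degree `|σ| = n + i`. -/
def homogeneousPart (k : Type u) [Field k] (n : ℕ) {m : ℕ} (Δ : LowerSet (Finset (Fin m)))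
    (d : ℕ) : (i : ℕ) → AddSubgroup ((sparseComplex k n Δ).X i)
  | 0 => (MvPolynomial.homogeneousSubmodule (Fin n ×ₗ Fin m) k d).toAddSubgroup
  | i + 1 =>
    { carrier := {c : chains k n Δ i | ∀ b, ∀ w ∈ (c.1 b).support, w.degree + (n + i) = d}
      zero_mem' := by
        intro b w hw
        exact absurd rfl (MvPolynomial.mem_support_iff.1 hw)
      add_mem' := by
        classical
        intro c c' hc hc' b w hw
        rcases Finset.mem_union.1 (MvPolynomial.support_add hw) with h | h
        · exact hc b w h
        · exact hc' b w h
      neg_mem' := by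
        intro c hc b w hw
        refine hc b w ?_
        rw [MvPolynomial.mem_support_iff] at hw ⊢
        intro h0
        refine hw ?_
        change MvPolynomial.coeff w (-(c.1 b)) = 0
        rw [MvPolynomial.coeff_neg, h0, neg_zero] }

/-- The graded piece `H_i(C^<_•(Δ, M))_d`: the homology classes of the cycles that are
homogeneous of internal degree `d`. -/
def homologyPart (k : Type u) [Field k] (n : ℕ) {m : ℕ} (Δ : LowerSet (Finset (Fin m)))
    (i d : ℕ) : AddSubgroup ((sparseComplex k n Δ).homology i) :=
  ((homogeneousPart k n Δ d i).comap
    ((sparseComplex k n Δ).iCycles i).hom.toAddMonoidHom).map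
    ((sparseComplex k n Δ).homologyπ i).hom.toAddMonoidHom

/-- `σ = {σ_1 < ⋯ < σ_l}` is an `i`-nonface of `Δ`: `σ ∉ Δ`, and for some `j`, the elements
`σ_j, …, σ_{j+i}` of `σ` exist and `σ \ σ_{j+t} ∈ Δ` for all `t = 0, …, i`. -/
def IsNonface {m : ℕ} (Δ : LowerSet (Finset (Fin m))) (i : ℕ) (σ : Finset (Fin m)) : Prop :=
  σ ∉ Δ ∧ ∃ j : ℕ, ∀ t ≤ i, ∃ h : j + t < σ.card,
    σ.erase (σ.orderEmbOfFin rfl ⟨j + t, h⟩) ∈ Δ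

end SparseEN

end

open CategoryTheory

/-! ### Cycles and homology classes of module complexes, in terms of elements -/

section ModuleComplexes

universe v w

variable {R : Type v} [Ring R] {ι : Type*} {c : ComplexShape ι}
  (K : HomologicalComplex (ModuleCat.{w} R) c)

/-! For `|σ| = n + 1`, the differential of `g^{*(ε_i)} ⊗ f_σ` is, up to sign, `x_{iσ_i} f_{σ∖σ_i} -
x_{iσ_{i+1}} f_{σ∖σ_{i+1}}`. This is a chain on `Δ` as soon as the two facets lie in `Δ`, even if
`σ` does not, and it is a cycle because the differentials compose to zero on the full simplex. If `σ
∉ Δ` it is not a boundary: the only basis element whose differential contains `x_{iσ_i} f_{σ∖σ_i}`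
is supported on `σ`, so at the point where `x_{iσ_i} = 1` and all other variables vanish, the
coefficient of `f_{σ∖σ_i}` is zero for boundaries but `±1` here (`eval_single_sparseDiff_eq_zero`).
Hence a 1-nonface yields nonzero homology.

Conversely, a 1-chain of degree `n + 1` is a `k`-combination of terms `x_{au} f_σ`, each of which
`d_1` sends to a monomial. A cycle therefore splits by monomial into groups with coefficient sum
zero, and each group is a combination of differences of two terms with the same image. Since
`in_<(det M_σ)` is the diagonal product, with one variable from each row, two such terms are equal
or differ by exchanging a variable in a single row `a` (`rowExp_add_single_eq`). In the union `ρ` of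
the two column sets, the exchanged columns are consecutive, at positions `a` and `a + 1`
(`exists_union_of_exchange`). Without 1-nonfaces `ρ ∈ Δ`, and the difference is `±d(g^{*(ε_a)} ⊗
f_ρ)` (`sub_mem_map_sparseDiff`). -/

theorem HomologicalComplex.moduleCat_exists_iCycles_eq {j l : ι} (hl : c.next j = l) (z : K.X j)
    (hz : (K.d j l).hom z = 0) : ∃ y : K.cycles j, (K.iCycles j).hom y = z := by
  have hex : (ShortComplex.mk (K.iCycles j) (K.d j l) (by simp)).Exact :=
    ShortComplex.exact_of_f_is_kernel _ (K.cyclesIsKernel j l hl)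
  exact (ShortComplex.moduleCat_exact_iff _).1 hex z hz

theorem HomologicalComplex.moduleCat_homologyπ_eq_zero_iff {i j : ι} (hi : c.prev j = i)
    (y : K.cycles j) :
    (K.homologyπ j).hom y = 0 ↔ ∃ b : K.X i, (K.d i j).hom b = (K.iCycles j).hom y := by
  have hcomp : ∀ b : K.X i, (K.iCycles j).hom ((K.toCycles i j).hom b) = (K.d i j).hom b :=
    fun b => by rw [← ModuleCat.comp_apply, K.toCycles_i]
  have hinj : Function.Injective (K.iCycles j).hom :=
    (ModuleCat.mono_iff_injective _).1 inferInstance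
  constructor
  · intro hy
    have hex : (ShortComplex.mk (K.toCycles i j) (K.homologyπ j) (by simp)).Exact :=
      ShortComplex.exact_of_g_is_cokernel _ (K.homologyIsCokernel i j hi)
    obtain ⟨b, hb⟩ := (ShortComplex.moduleCat_exact_iff _).1 hex y hy
    exact ⟨b, (hcomp b).symm.trans (congrArg _ hb)⟩
  · rintro ⟨b, hb⟩
    obtain rfl : (K.toCycles i j).hom b = y := hinj ((hcomp b).trans hb)
    rw [← ModuleCat.comp_apply, K.toCycles_comp_homologyπ]
    rfl

end ModuleComplexes

namespace SparseEN

universe u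

variable {k : Type u} [Field k] {n m : ℕ}

/-! ### Reduction of graded homology to explicit chains -/

/-- Only the cycle is required to be homogeneous: a homology class is zero as soon as some chain, of
whatever degrees, bounds it. -/
theorem homologyPart_eq_bot_iff (Δ : LowerSet (Finset (Fin m))) (i d : ℕ) :
    homologyPart k n Δ (i + 1) d = ⊥ ↔
      ∀ z ∈ homogeneousPart k n Δ d (i + 1), ((sparseComplex k n Δ).d (i + 1) i).hom z = 0 →
        ∃ y, ((sparseComplex k n Δ).d (i + 2) (i + 1)).hom y = z := by
  rw [homologyPart, AddSubgroup.map_eq_bot_iff]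
  constructor
  · intro h z hz hdz
    obtain ⟨y, rfl⟩ := (sparseComplex k n Δ).moduleCat_exists_iCycles_eq (l := i) (by simp) z hdz
    exact ((sparseComplex k n Δ).moduleCat_homologyπ_eq_zero_iff (by simp) y).1 (h hz)
  · intro h y hy
    refine ((sparseComplex k n Δ).moduleCat_homologyπ_eq_zero_iff (by simp) y).2 (h _ hy ?_)
    rw [← ModuleCat.comp_apply, HomologicalComplex.iCycles_d]
    rfl

theorem sparseComplex_d_one_zero_apply (Δ : LowerSet (Finset (Fin m))) (z : chains k n Δ 0) :
    ((sparseComplex k n Δ).d 1 0).hom z = initialDiff k n m (z : Ambient k n m) := by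
  have h : (sparseComplex k n Δ).d 1 0 = complexD k n Δ 0 :=
    ChainComplex.of_d (complexX k n Δ) (complexD k n Δ) 0
  rw [h]
  rfl

theorem sparseComplex_d_two_one_apply (Δ : LowerSet (Finset (Fin m))) (y : chains k n Δ 1) :
    ((sparseComplex k n Δ).d 2 1).hom y =
      (sparseDiff k n m).restrict (sparseDiff_mem Δ 0) y := by
  have h : (sparseComplex k n Δ).d 2 1 = complexD k n Δ 1 :=
    ChainComplex.of_d (complexX k n Δ) (complexD k n Δ) 1
  rw [h]
  rfl

theorem exists_d_two_one_eq_iff (Δ : LowerSet (Finset (Fin m))) (z : chains k n Δ 0) :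
    (∃ y, ((sparseComplex k n Δ).d 2 1).hom y = z) ↔
      (z : Ambient k n m) ∈ (chains k n Δ 1).map (sparseDiff k n m) := by
  constructor
  · rintro ⟨y, hy⟩
    refine ⟨(show chains k n Δ 1 from y).1, (show chains k n Δ 1 from y).2, ?_⟩
    rw [← hy]
    exact congrArg Subtype.val (sparseComplex_d_two_one_apply Δ y).symm
  · rintro ⟨y, hy, hyz⟩
    exact ⟨(⟨y, hy⟩ : chains k n Δ 1),
      (sparseComplex_d_two_one_apply Δ ⟨y, hy⟩).trans (Subtype.ext hyz)⟩

/-- Lets the constraints on `α` and `σ` be read off from each index in the support of a chain. -/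
theorem chains_eq_supported (Δ : LowerSet (Finset (Fin m))) (i : ℕ) :
    chains k n Δ i = Finsupp.supported (PolyRing k n m) (PolyRing k n m)
      {b | ∑ l, b.1 l = i ∧ b.2.card = n + i ∧ b.2 ∈ Δ} := by
  rw [Finsupp.supported_eq_span_single, chains]
  congr 1
  ext c
  constructor
  · rintro ⟨α, σ, h1, h2, h3, rfl⟩
    exact ⟨(α, σ), ⟨h1, h2, h3⟩, rfl⟩
  · rintro ⟨⟨α, σ⟩, ⟨h1, h2, h3⟩, rfl⟩
    exact ⟨α, σ, h1, h2, h3, rfl⟩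

/-! ### The cycle attached to a set of `n + 1` columns, and why it does not bound -/

/-- For `α = ε_i` the index set allows only the consecutive positions `i` and `i + 1`, which carry
opposite signs. -/
theorem sparseDiff_basisElt_single (i : Fin n) (σ : Finset (Fin m)) (h : σ.card = n + 1) :
    sparseDiff k n m (basisElt k (Pi.single i 1) σ) = (-1 : PolyRing k n m) ^ (i : ℕ) •
      (x k i (σ.orderEmbOfFin h i.castSucc) •
          basisElt k 0 (σ.erase (σ.orderEmbOfFin h i.castSucc)) -
        x k i (σ.orderEmbOfFin h i.succ) •
          basisElt k 0 (σ.erase (σ.orderEmbOfFin h i.succ))) := by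
  have hne : (i, σ.orderEmbOfFin h i.castSucc) ≠ (i, σ.orderEmbOfFin h i.succ) := fun he =>
    (Fin.castSucc_lt_succ (i := i)).ne ((σ.orderEmbOfFin h).injective (Prod.mk.inj he).2)
  rw [sparseDiff_basisElt, indexSet_single i σ h, Finset.sum_pair hne]
  simp only [pos_orderEmb, tsub_self, Fin.val_castSucc, Fin.val_succ, smul_sub, smul_smul,
    pow_succ, mul_neg, mul_one, neg_mul, neg_smul]
  rw [sub_eq_add_neg]

theorem basisElt_single_mem_chains (Δ : LowerSet (Finset (Fin m))) (i : Fin n)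
    (σ : Finset (Fin m)) (h : σ.card = n + 1) (hσ : σ ∈ Δ) :
    basisElt k (Pi.single i 1) σ ∈ chains k n Δ 1 :=
  Submodule.subset_span ⟨_, σ, by simp, h, hσ, rfl⟩

theorem card_erase_orderEmbOfFin (σ : Finset (Fin m)) (h : σ.card = n + 1) (p : Fin (n + 1)) :
    (σ.erase (σ.orderEmbOfFin h p)).card = n := by
  rw [Finset.card_erase_of_mem (Finset.orderEmbOfFin_mem _ _ _), h]; rfl

theorem sparseDiff_basisElt_single_mem (Δ : LowerSet (Finset (Fin m))) (i : Fin n)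
    (σ : Finset (Fin m)) (h : σ.card = n + 1)
    (h1 : σ.erase (σ.orderEmbOfFin h i.castSucc) ∈ Δ)
    (h2 : σ.erase (σ.orderEmbOfFin h i.succ) ∈ Δ) :
    sparseDiff k n m (basisElt k (Pi.single i 1) σ) ∈ chains k n Δ 0 := by
  have hb : ∀ p, σ.erase (σ.orderEmbOfFin h p) ∈ Δ →
      basisElt k 0 (σ.erase (σ.orderEmbOfFin h p)) ∈ chains k n Δ 0 := fun p hp =>
    Submodule.subset_span ⟨0, _, by simp, card_erase_orderEmbOfFin σ h p, hp, rfl⟩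
  rw [sparseDiff_basisElt_single i σ h]
  exact Submodule.smul_mem _ _ (Submodule.sub_mem _ (Submodule.smul_mem _ _ (hb _ h1))
    (Submodule.smul_mem _ _ (hb _ h2)))

theorem initialDiff_sparseDiff_basisElt_single (i : Fin n) (σ : Finset (Fin m))
    (h : σ.card = n + 1) :
    initialDiff k n m (sparseDiff k n m (basisElt k (Pi.single i 1) σ)) = 0 :=
  -- The identity is applied on the full simplex, so that `σ` need not lie in `Δ`.
  initialDiff_sparseDiff ⊤ _ (basisElt_single_mem_chains ⊤ i σ h trivial)

/-- If `v ∈ σ` and `σ ∉ Δ`, then in a boundary of a chain on `Δ` the coefficient of `f_{σ \ v}`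
vanishes at the point whose only nonzero coordinate is the `(i, v)`-th one. -/
theorem eval_single_sparseDiff_eq_zero (Δ : LowerSet (Finset (Fin m))) (i : Fin n)
    (σ : Finset (Fin m)) (v : Fin m) (hv : v ∈ σ) (hσ : σ ∉ Δ) (q : ℕ) (c : Ambient k n m)
    (hc : c ∈ chains k n Δ q) :
    MvPolynomial.eval (Pi.single (toLex (i, v)) (1 : k))
      (sparseDiff k n m c (0, σ.erase v)) = 0 := by
  -- The kernel of evaluation is an ideal, so the condition cuts out a submodule and need only be
  -- checked on basis elements.
  suffices h : chains k n Δ q ≤ Submodule.comap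
      ((Finsupp.lapply (0, σ.erase v)).comp (sparseDiff k n m))
      (RingHom.ker (MvPolynomial.eval (Pi.single (toLex (i, v)) (1 : k)))) from h hc
  refine Submodule.span_le.2 ?_
  rintro _ ⟨α, ρ, -, -, hρ, rfl⟩
  change MvPolynomial.eval _ (sparseDiff k n m (basisElt k α ρ) (0, σ.erase v)) = 0
  rw [sparseDiff_basisElt, Finsupp.finsetSum_apply, map_sum]
  refine Finset.sum_eq_zero fun p hp => ?_
  rw [Finsupp.smul_apply, smul_eq_mul, map_mul, map_mul, MvPolynomial.eval_X]
  -- Every variable other than `x_{iv}` vanishes at the point. The term with `x_{iv}` could reach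
  -- `f_{σ∖v}` only from `ρ = σ`, which is excluded by `ρ ∈ Δ`.
  by_cases hpv : p = (i, v)
  · subst hpv
    have hvρ : v ∈ ρ := (Finset.mem_filter.1 hp).2.2.1
    have hne : ρ.erase v ≠ σ.erase v := fun he => hσ (by
      rw [← Finset.insert_erase hv, ← he, Finset.insert_erase hvρ]
      exact hρ)
    rw [basisElt, Finsupp.single_eq_of_ne, map_zero, mul_zero]
    exact fun he => hne (Prod.mk.inj he).2.symm
  · rw [Pi.single_eq_of_ne, mul_zero, zero_mul]
    exact fun he => hpv (toLex.injective he)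

/-- The coefficient of `f_{σ∖σ_i}` is `±x_{iσ_i}`, whose value at the test point is `±1`, whereas a
boundary gives `0` there. -/
theorem sparseDiff_basisElt_single_notMem_map (Δ : LowerSet (Finset (Fin m))) (i : Fin n)
    (σ : Finset (Fin m)) (h : σ.card = n + 1) (hσ : σ ∉ Δ) :
    sparseDiff k n m (basisElt k (Pi.single i 1) σ) ∉
      (chains k n Δ 1).map (sparseDiff k n m) := by
  rintro ⟨y, hy, hyz⟩
  have h0 := eval_single_sparseDiff_eq_zero Δ i σ (σ.orderEmbOfFin h i.castSucc)
    (Finset.orderEmbOfFin_mem _ _ _) hσ 1 y hy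
  have hne : σ.erase (σ.orderEmbOfFin h i.castSucc) ≠ σ.erase (σ.orderEmbOfFin h i.succ) := by
    intro he
    have h1 : σ.orderEmbOfFin h i.succ ∈ σ.erase (σ.orderEmbOfFin h i.castSucc) :=
      Finset.mem_erase.2 ⟨fun e => (Fin.castSucc_lt_succ (i := i)).ne'
        ((σ.orderEmbOfFin h).injective e), Finset.orderEmbOfFin_mem _ _ _⟩
    rw [he] at h1
    exact Finset.notMem_erase _ _ h1
  rw [hyz, sparseDiff_basisElt_single i σ h] at h0
  simp [basisElt, hne] at h0

theorem sparseDiff_basisElt_single_homogeneous (i : Fin n) (σ : Finset (Fin m))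
    (h : σ.card = n + 1) (b : (Fin n → ℕ) × Finset (Fin m)) :
    (sparseDiff k n m (basisElt k (Pi.single i 1) σ) b).IsHomogeneous 1 := by
  classical
  have hb : ∀ τ, (basisElt k (0 : Fin n → ℕ) τ b).IsHomogeneous 0 := fun τ => by
    rw [basisElt, Finsupp.single_apply]
    split_ifs
    · exact MvPolynomial.isHomogeneous_one _ _
    · exact MvPolynomial.isHomogeneous_zero _ _ _
  rw [sparseDiff_basisElt_single i σ h]
  have hs : ((-1 : PolyRing k n m) ^ (i : ℕ)).IsHomogeneous 0 := by
    simpa using ((MvPolynomial.isHomogeneous_one (Fin n ×ₗ Fin m) k).neg).pow (i : ℕ)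
  have := hs.mul (((MvPolynomial.isHomogeneous_X k
    (toLex (i, σ.orderEmbOfFin h i.castSucc))).mul (hb (σ.erase (σ.orderEmbOfFin h i.castSucc)))).sub
    ((MvPolynomial.isHomogeneous_X k
    (toLex (i, σ.orderEmbOfFin h i.succ))).mul (hb (σ.erase (σ.orderEmbOfFin h i.succ)))))
  simpa using this

/-! ### Diagonal monomials and exchanges within one row -/

theorem prod_x_eq_monomial (c : Fin n → Fin m) :
    ∏ i, x k i (c i) = MvPolynomial.monomial (rowExp c) 1 := by
  rw [rowExp, MvPolynomial.monomial_sum_one]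
  rfl

theorem sum_rowExp_row (c : Fin n → Fin m) (i : Fin n) :
    ∑ v, rowExp c (toLex (i, v)) = 1 := by
  simp [rowExp_apply]

theorem sum_single_row (a i : Fin n) (u : Fin m) :
    ∑ v, (Finsupp.single (toLex (a, u)) 1 : (Fin n ×ₗ Fin m) →₀ ℕ) (toLex (i, v)) =
      if a = i then 1 else 0 := by
  by_cases h : a = i <;> simp [Finsupp.single_apply, h]

/-- A coincidence `x_{au} ∏ᵢ x_{i, s(i)} = x_{bv} ∏ᵢ x_{i, t(i)}` is either trivial, or an exchange
of variables in a single row. -/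
theorem rowExp_add_single_eq {s t : Fin n → Fin m} {a b : Fin n} {u v : Fin m}
    (h : rowExp s + Finsupp.single (toLex (a, u)) 1 =
      rowExp t + Finsupp.single (toLex (b, v)) 1) :
    a = b ∧ (∀ i, i ≠ a → s i = t i) ∧
      ((s a = t a ∧ u = v) ∨ (s a ≠ t a ∧ u = t a ∧ v = s a)) := by
  -- Total degree in each row: the diagonal monomials contribute `1` to every row, so the extra
  -- variables must lie in the same row.
  have hab : a = b := by
    have h1 := congrArg (fun e : (Fin n ×ₗ Fin m) →₀ ℕ => ∑ w, e (toLex (a, w))) h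
    simp only [Finsupp.add_apply, Finset.sum_add_distrib, sum_rowExp_row, sum_single_row] at h1
    by_contra hne
    simp [Ne.symm hne] at h1
  subst hab
  have hv : ∀ i w, (if s i = w then 1 else 0) + (if a = i ∧ u = w then 1 else 0) =
      (if t i = w then 1 else 0) + (if a = i ∧ v = w then 1 else 0) := by
    intro i w
    have := DFunLike.congr_fun h (toLex (i, w))
    simpa [rowExp_apply, Finsupp.single_apply] using this
  refine ⟨rfl, fun i hi => ?_, ?_⟩
  · have := hv i (s i)
    by_contra hne
    simp [Ne.symm hi, Ne.symm hne] at this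
  -- In row `a` the multisets `{s a, u}` and `{t a, v}` coincide; comparing multiplicities at `s a`,
  -- `t a` and `u` separates the two cases.
  · have h1 := hv a (s a)
    have h2 := hv a (t a)
    have h3 := hv a u
    by_cases hst : s a = t a
    · left
      refine ⟨hst, ?_⟩
      by_contra hne
      simp [hst, Ne.symm hne] at h3
    · right
      have hts := Ne.symm hst
      refine ⟨hst, ?_, ?_⟩
      · by_contra hne
        simp [hst, hne] at h2
        omega
      · by_contra hne
        simp [hts, hne] at h1

/-- The set `ρ` is `σ ∪ τ`. Both enumerations agree away from `a`, so no other column lies between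
`σ_a` and `τ_a`. -/
theorem exists_union_of_exchange (σ τ : Finset (Fin m)) (hσ : σ.card = n) (hτ : τ.card = n)
    (a : Fin n) (hne : ∀ i, i ≠ a → σ.orderEmbOfFin hσ i = τ.orderEmbOfFin hτ i)
    (hlt : σ.orderEmbOfFin hσ a < τ.orderEmbOfFin hτ a) :
    ∃ (ρ : Finset (Fin m)) (hρ : ρ.card = n + 1),
      ρ.orderEmbOfFin hρ a.castSucc = σ.orderEmbOfFin hσ a ∧
      ρ.orderEmbOfFin hρ a.succ = τ.orderEmbOfFin hτ a ∧
      ρ.erase (ρ.orderEmbOfFin hρ a.castSucc) = τ ∧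
      ρ.erase (ρ.orderEmbOfFin hρ a.succ) = σ := by
  set s := σ.orderEmbOfFin hσ with hs
  set t := τ.orderEmbOfFin hτ with ht
  have hmemσ : ∀ w, w ∈ σ ↔ ∃ i, s i = w := fun w => by
    rw [← Set.mem_range, hs, Finset.range_orderEmbOfFin, Finset.mem_coe]
  have hmemτ : ∀ w, w ∈ τ ↔ ∃ i, t i = w := fun w => by
    rw [← Set.mem_range, ht, Finset.range_orderEmbOfFin, Finset.mem_coe]
  have htσ : t a ∉ σ := by
    rw [hmemσ]
    rintro ⟨i, hi⟩
    by_cases hia : i = a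
    · subst hia; exact hlt.ne hi
    · rw [hne i hia] at hi
      exact hia (t.injective hi)
  have hρ : (insert (t a) σ).card = n + 1 := by rw [Finset.card_insert_of_notMem htσ, hσ]
  -- The increasing enumeration of the union is `s_0, …, s_a, t_a, …, t_{n-1}`; it increases at the
  -- junction because `s_a < t_a`.
  let g : Fin (n + 1) → Fin m := fun p =>
    if hp : p.val ≤ a.val then s ⟨p.val, by omega⟩ else t ⟨p.val - 1, by omega⟩
  have hg : StrictMono g := by
    intro p q hpq
    have hpq' : p.val < q.val := hpq
    by_cases hp : p.val ≤ a.val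
    · by_cases hq : q.val ≤ a.val
      · simp only [g, hp, hq, dif_pos]
        exact s.strictMono hpq'
      · simp only [g, hp, hq, dif_pos, dif_neg, not_false_eq_true]
        refine lt_of_le_of_lt (s.monotone (b := a) hp) (hlt.trans_le (t.monotone ?_))
        rw [Fin.le_def]
        change a.val ≤ q.val - 1
        omega
    · have hq : ¬ q.val ≤ a.val := by omega
      simp only [g, hp, hq, dif_neg, not_false_eq_true]
      refine t.strictMono ?_
      rw [Fin.lt_def]
      change p.val - 1 < q.val - 1
      omega
  have hgmem : ∀ p, g p ∈ insert (t a) σ := by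
    intro p
    by_cases hp : p.val ≤ a.val
    · simp only [g, hp, dif_pos]
      exact Finset.mem_insert_of_mem ((hmemσ _).2 ⟨_, rfl⟩)
    · simp only [g, hp, dif_neg, not_false_eq_true]
      rw [Finset.mem_insert]
      by_cases hi : (⟨p.val - 1, by omega⟩ : Fin n) = a
      · left; rw [hi]
      · right; rw [← hne _ hi]; exact (hmemσ _).2 ⟨_, rfl⟩
  have hgeq : g = (insert (t a) σ).orderEmbOfFin hρ :=
    Finset.orderEmbOfFin_unique hρ hgmem hg
  have h1 : (insert (t a) σ).orderEmbOfFin hρ a.castSucc = s a := by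
    rw [← hgeq]; simp [g]
  have h2 : (insert (t a) σ).orderEmbOfFin hρ a.succ = t a := by
    rw [← hgeq]; simp [g]
  refine ⟨insert (t a) σ, hρ, h1, h2, ?_, ?_⟩
  · symm
    refine Finset.eq_of_subset_of_card_le ?_ (by rw [card_erase_orderEmbOfFin, hτ])
    intro w hw
    obtain ⟨i, rfl⟩ := (hmemτ w).1 hw
    rw [h1, Finset.mem_erase, Finset.mem_insert]
    by_cases hia : i = a
    · subst hia; exact ⟨hlt.ne', Or.inl rfl⟩
    · rw [← hne i hia]
      exact ⟨fun e => hia (s.injective e), Or.inr ((hmemσ _).2 ⟨_, rfl⟩)⟩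
  · rw [h2, Finset.erase_insert htσ]

/-! ### 1-nonfaces and homologous terms -/

theorem isNonface_one_of_notMem (Δ : LowerSet (Finset (Fin m))) (σ : Finset (Fin m))
    (h : σ.card = n + 1) (j : Fin n) (hσ : σ ∉ Δ)
    (h1 : σ.erase (σ.orderEmbOfFin h j.castSucc) ∈ Δ)
    (h2 : σ.erase (σ.orderEmbOfFin h j.succ) ∈ Δ) : IsNonface Δ 1 σ := by
  have hcast : ∀ p : Fin (n + 1), σ.orderEmbOfFin rfl ⟨p.val, by omega⟩ = σ.orderEmbOfFin h p :=
    fun p => by simp [Finset.orderEmbOfFin_eq_orderEmbOfFin_iff]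
  refine ⟨hσ, j, fun t ht => ?_⟩
  have hj := j.2
  rcases (by omega : t = 0 ∨ t = 1) with rfl | rfl
  · exact ⟨by omega, by rw [← hcast] at h1; exact h1⟩
  · exact ⟨by omega, by rw [← hcast] at h2; exact h2⟩

theorem IsNonface.exists_fin (Δ : LowerSet (Finset (Fin m))) (σ : Finset (Fin m))
    (h : σ.card = n + 1) (hσ : IsNonface Δ 1 σ) :
    ∃ j : Fin n, σ.erase (σ.orderEmbOfFin h j.castSucc) ∈ Δ ∧
      σ.erase (σ.orderEmbOfFin h j.succ) ∈ Δ := by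
  have hcast : ∀ p : Fin (n + 1), σ.orderEmbOfFin rfl ⟨p.val, by omega⟩ = σ.orderEmbOfFin h p :=
    fun p => by simp [Finset.orderEmbOfFin_eq_orderEmbOfFin_iff]
  obtain ⟨-, j, hj⟩ := hσ
  obtain ⟨l0, h0⟩ := hj 0 zero_le_one
  obtain ⟨l1, h1⟩ := hj 1 le_rfl
  refine ⟨⟨j, by omega⟩, ?_, ?_⟩
  · rw [← hcast]; exact h0
  · rw [← hcast]; exact h1

/-- If `Δ` has no `1`-nonface of cardinality `n + 1`, two terms `x_e f_σ`, `x_{e'} f_τ` of the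
same multidegree are homologous. -/
theorem sub_mem_map_sparseDiff (Δ : LowerSet (Finset (Fin m)))
    (hΔ : ∀ σ : Finset (Fin m), σ.card = n + 1 → ¬ IsNonface Δ 1 σ)
    (σ τ : Finset (Fin m)) (hσ : σ.card = n) (hτ : τ.card = n) (hσΔ : σ ∈ Δ) (hτΔ : τ ∈ Δ)
    (a b : Fin n) (u v : Fin m)
    (h : rowExp (σ.orderEmbOfFin hσ) + Finsupp.single (toLex (a, u)) 1 =
      rowExp (τ.orderEmbOfFin hτ) + Finsupp.single (toLex (b, v)) 1) :
    x k a u • basisElt k (0 : Fin n → ℕ) σ - x k b v • basisElt k 0 τ ∈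
      (chains k n Δ 1).map (sparseDiff k n m) := by
  obtain ⟨rfl, hne, ⟨hst, rfl⟩ | ⟨hst, rfl, rfl⟩⟩ := rowExp_add_single_eq h
  · have : σ = τ := by
      rw [← Finset.coe_inj, ← Finset.range_orderEmbOfFin σ hσ, ← Finset.range_orderEmbOfFin τ hτ]
      congr 1
      funext i
      by_cases hi : i = a
      · rw [hi, hst]
      · exact hne i hi
    subst this
    simp
  -- The exchange is symmetric up to sign, so it suffices to treat `σ_a < τ_a`.
  · have key : ∀ (σ τ : Finset (Fin m)) (hσ : σ.card = n) (hτ : τ.card = n), σ ∈ Δ → τ ∈ Δ →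
        (∀ i, i ≠ a → σ.orderEmbOfFin hσ i = τ.orderEmbOfFin hτ i) →
        σ.orderEmbOfFin hσ a < τ.orderEmbOfFin hτ a →
        x k a (τ.orderEmbOfFin hτ a) • basisElt k (0 : Fin n → ℕ) σ -
          x k a (σ.orderEmbOfFin hσ a) • basisElt k 0 τ ∈
            (chains k n Δ 1).map (sparseDiff k n m) := by
      intro σ τ hσ hτ hσΔ hτΔ hne hlt
      obtain ⟨ρ, hρ, e1, e2, e3, e4⟩ := exists_union_of_exchange σ τ hσ hτ a hne hlt
      -- Deleting the consecutive elements of `ρ` at positions `a` and `a + 1` gives `τ` and `σ`,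
      -- both in `Δ`; otherwise `ρ` would be a 1-nonface.
      have hρΔ : ρ ∈ Δ := by
        by_contra hcon
        exact hΔ ρ hρ (isNonface_one_of_notMem Δ ρ hρ a hcon (e3 ▸ hτΔ) (e4 ▸ hσΔ))
      -- The factor `(-1)^a` cancels the sign of the differential, and the extra minus puts the term
      -- on `σ` in front.
      refine ⟨(-(-1 : PolyRing k n m) ^ (a : ℕ)) • basisElt k (Pi.single a 1) ρ,
        Submodule.smul_mem _ _ (basisElt_single_mem_chains Δ a ρ hρ hρΔ), ?_⟩
      rw [map_smul, sparseDiff_basisElt_single a ρ hρ, e3, e4, e1, e2, smul_smul, neg_mul,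
        ← pow_add, Even.neg_one_pow ⟨_, rfl⟩, neg_smul, one_smul, neg_sub]
    rcases lt_or_gt_of_ne hst with hlt | hlt
    · exact key σ τ hσ hτ hσΔ hτΔ hne hlt
    · rw [← neg_sub]
      exact Submodule.neg_mem _ (key τ σ hτ hσ hτΔ hσΔ (fun i hi => (hne i hi).symm) hlt)

/-- The exponent of the initial term of the maximal minor on the columns in `σ`. -/
noncomputable def initialExp (n : ℕ) {m : ℕ} (σ : Finset (Fin m)) : (Fin n ×ₗ Fin m) →₀ ℕ :=
  if h : σ.card = n then rowExp (σ.orderEmbOfFin h) else 0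

theorem initialExp_eq (σ : Finset (Fin m)) (h : σ.card = n) :
    initialExp n σ = rowExp (σ.orderEmbOfFin h) := dif_pos h

theorem initialDiff_basisElt_eq_monomial (α : Fin n → ℕ) (σ : Finset (Fin m)) (h : σ.card = n) :
    initialDiff k n m (basisElt k α σ) = MvPolynomial.monomial (initialExp n σ) 1 := by
  rw [initialDiff_basisElt α σ h, prod_x_eq_monomial, initialExp_eq σ h]

/-! ### Splitting a cycle by the monomials in its image -/

theorem ambient_eq_sum_monomial (z : Ambient k n m) :
    z = ∑ t ∈ z.support.sigma (fun b => (z b).support),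
      (MvPolynomial.C (MvPolynomial.coeff t.2 (z t.1)) : PolyRing k n m) •
        ((MvPolynomial.monomial t.2 (1 : k) : PolyRing k n m) • basisElt k t.1.1 t.1.2) := by
  rw [Finset.sum_sigma]
  conv_lhs => rw [← Finsupp.sum_single z, Finsupp.sum]
  refine Finset.sum_congr rfl fun b _ => ?_
  simp only [smul_smul, MvPolynomial.C_mul_monomial, mul_one]
  rw [← Finset.sum_smul, MvPolynomial.support_sum_monomial_coeff, basisElt, Finsupp.smul_single,
    smul_eq_mul, mul_one]

/-- The map `d_1` sends each term to a monomial, so the cycle condition is a separate linear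
relation on scalars for each monomial. -/
theorem mem_map_sparseDiff_of_cycle (Δ : LowerSet (Finset (Fin m)))
    (hΔ : ∀ σ : Finset (Fin m), σ.card = n + 1 → ¬ IsNonface Δ 1 σ)
    (z : Ambient k n m) (hz : z ∈ chains k n Δ 0)
    (hdeg : ∀ b, ∀ w ∈ (z b).support, w.degree = 1) (hdz : initialDiff k n m z = 0) :
    z ∈ (chains k n Δ 1).map (sparseDiff k n m) := by
  classical
  set T := z.support.sigma (fun b => (z b).support)
  have hT : ∀ t ∈ T, t.1.1 = 0 ∧ t.1.2.card = n ∧ t.1.2 ∈ Δ ∧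
      ∃ (a : Fin n) (u : Fin m), t.2 = Finsupp.single (toLex (a, u)) 1 := by
    intro t ht
    obtain ⟨h1, h2⟩ := Finset.mem_sigma.1 ht
    rw [chains_eq_supported] at hz
    obtain ⟨hα, hc, hσ⟩ := hz h1
    refine ⟨funext fun l => ?_, hc, hσ, ?_⟩
    · exact Finset.sum_eq_zero_iff.1 hα l (Finset.mem_univ l)
    · obtain ⟨e, he⟩ := Finsupp.sum_eq_one_iff _ |>.1 (hdeg _ _ h2)
      exact ⟨(ofLex e).1, (ofLex e).2, he⟩
  have hcoeff : ∀ W, ∑ t ∈ T with t.2 + initialExp n t.1.2 = W,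
      MvPolynomial.coeff t.2 (z t.1) = 0 := by
    intro W
    have h0 : MvPolynomial.coeff W (initialDiff k n m z) = 0 := by rw [hdz, MvPolynomial.coeff_zero]
    rw [ambient_eq_sum_monomial z, map_sum, MvPolynomial.coeff_sum] at h0
    rw [Finset.sum_filter]
    refine Eq.trans ?_ h0
    refine Finset.sum_congr rfl fun t ht => ?_
    rw [map_smul, map_smul, initialDiff_basisElt_eq_monomial _ _ (hT t ht).2.1, smul_eq_mul,
      smul_eq_mul, MvPolynomial.monomial_mul, MvPolynomial.C_mul_monomial,
      MvPolynomial.coeff_monomial, mul_one, mul_one]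
  rw [ambient_eq_sum_monomial z, ← Finset.sum_fiberwise_of_maps_to
    (t := T.image fun t => t.2 + initialExp n t.1.2) (g := fun t => t.2 + initialExp n t.1.2)
    (fun t ht => Finset.mem_image_of_mem _ ht)]
  refine Submodule.sum_mem _ fun W hW => ?_
  obtain ⟨t₀, ht₀, rfl⟩ := Finset.mem_image.1 hW
  -- A reference term for the fibre. The coefficients over the fibre sum to zero, so subtracting
  -- `e₀` from every term does not change the sum and leaves only differences of terms with equal
  -- image.
  set e₀ : Ambient k n m := MvPolynomial.monomial t₀.2 (1 : k) • basisElt k t₀.1.1 t₀.1.2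
  have hsum : ∑ t ∈ T with t.2 + initialExp n t.1.2 = t₀.2 + initialExp n t₀.1.2,
      (MvPolynomial.C (MvPolynomial.coeff t.2 (z t.1)) : PolyRing k n m) • e₀ = 0 := by
    rw [← Finset.sum_smul, ← map_sum, hcoeff, map_zero, zero_smul]
  rw [← sub_zero (Finset.sum _ _), ← hsum, ← Finset.sum_sub_distrib]
  refine Submodule.sum_mem _ fun t ht => ?_
  obtain ⟨ht, heq⟩ := Finset.mem_filter.1 ht
  rw [← smul_sub]
  refine Submodule.smul_mem _ _ ?_
  obtain ⟨hα, hc, hσ, a, u, hw⟩ := hT t ht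
  obtain ⟨hα₀, hc₀, hσ₀, b, v, hw₀⟩ := hT t₀ ht₀
  simp only [e₀]
  rw [initialExp_eq _ hc, initialExp_eq _ hc₀, hw, hw₀, add_comm, add_comm (Finsupp.single _ _)]
    at heq
  rw [hw, hw₀, hα, hα₀]
  exact sub_mem_map_sparseDiff Δ hΔ _ _ hc hc₀ hσ hσ₀ a b u v heq

theorem homologyPart_one_eq_bot_of_forall_not_isNonface (Δ : LowerSet (Finset (Fin m)))
    (hΔ : ∀ σ : Finset (Fin m), σ.card = n + 1 → ¬ IsNonface Δ 1 σ) :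
    homologyPart k n Δ 1 (n + 1) = ⊥ := by
  rw [homologyPart_eq_bot_iff]
  intro z hz hdz
  refine (exists_d_two_one_eq_iff Δ z).2 (mem_map_sparseDiff_of_cycle Δ hΔ _
    (show chains k n Δ 0 from z).2 (fun b w hw => ?_)
    ((sparseComplex_d_one_zero_apply Δ z).symm.trans hdz))
  -- Since `f_σ` has degree `n`, internal degree `n + 1` means linear coefficients.
  have : w.degree + (n + 0) = n + 1 := hz b w hw
  omega

end SparseEN

/-! ### The equivalence and the explicit cycle -/

open SparseEN in
theorem mainTheorem6 {k : Type*} [Field k] {n m : ℕ} (hnm : n ≤ m)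
    (Δ : LowerSet (Finset (Fin m))) :
    (homologyPart k n Δ 1 (n + 1) = ⊥ ↔
      ¬ ∃ σ : Finset (Fin m), σ.card = n + 1 ∧ IsNonface Δ 1 σ) ∧
    (∀ (σ : Finset (Fin m)) (hσ : σ.card = n + 1) (j : Fin n), σ ∉ Δ →
      σ.erase (σ.orderEmbOfFin hσ j.castSucc) ∈ Δ →
      σ.erase (σ.orderEmbOfFin hσ j.succ) ∈ Δ →
      ∃ z : chains k n Δ 0,
        (z : Ambient k n m) = (-1 : PolyRing k n m) ^ (j : ℕ) •
          (x k j (σ.orderEmbOfFin hσ j.castSucc) •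
              basisElt k 0 (σ.erase (σ.orderEmbOfFin hσ j.castSucc)) -
            x k j (σ.orderEmbOfFin hσ j.succ) •
              basisElt k 0 (σ.erase (σ.orderEmbOfFin hσ j.succ))) ∧
        ((sparseComplex k n Δ).d 1 0).hom z = 0 ∧
        ¬ ∃ y, ((sparseComplex k n Δ).d 2 1).hom y = z) := by
  refine ⟨⟨?_, fun h => homologyPart_one_eq_bot_of_forall_not_isNonface Δ
    fun σ hc hσ => h ⟨σ, hc, hσ⟩⟩, ?_⟩
  · rintro h ⟨σ, hc, hσ⟩
    obtain ⟨j, h1, h2⟩ := hσ.exists_fin Δ σ hc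
    -- Vanishing homology would make the cycle attached to the nonface a boundary, since that cycle
    -- has linear coefficients and so degree `n + 1`.
    rw [homologyPart_eq_bot_iff] at h
    have hz := sparseDiff_basisElt_single_mem (k := k) Δ j σ hc h1 h2
    refine sparseDiff_basisElt_single_notMem_map (k := k) Δ j σ hc hσ.1
      ((exists_d_two_one_eq_iff Δ ⟨_, hz⟩).1 (h _ (fun b w hw => ?_)
        ((sparseComplex_d_one_zero_apply Δ ⟨_, hz⟩).trans
          (initialDiff_sparseDiff_basisElt_single j σ hc))))
    have hd : w.degree = 1 := by
      rw [Finsupp.degree_eq_weight_one]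
      exact sparseDiff_basisElt_single_homogeneous j σ hc b (MvPolynomial.mem_support_iff.1 hw)
    exact (congrArg (· + (n + 0)) hd).trans (add_comm _ _)
  · intro σ hc j hσ h1 h2
    have hz := sparseDiff_basisElt_single_mem (k := k) Δ j σ hc h1 h2
    exact ⟨⟨_, hz⟩, sparseDiff_basisElt_single j σ hc,
      (sparseComplex_d_one_zero_apply Δ ⟨_, hz⟩).trans
        (initialDiff_sparseDiff_basisElt_single j σ hc),
      fun hy => sparseDiff_basisElt_single_notMem_map Δ j σ hc hσ
        ((exists_d_two_one_eq_iff Δ ⟨_, hz⟩).1 hy)⟩
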